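/- Let $n,m\in\mathbb N$, and let $f:\mathbb R^n\times\mathbb R^m\to\mathbb R^n$ and $r:\mathbb R^n\times\mathbb R^m\to\mathbb R$ be bounded and Lipschitz continuous with respect to the Euclidean norms. Let $\mathrm{Lip}(f)$ be the least Lipschitz constant of $f$ and assume $\gamma>\mathrm{Lip}(f)$. For $L>0$ let $$Q^L(x,a)=\sup\int_0^\infty e^{-\gamma s}\,r(x(s),a(s))\,ds,$$ where the supremum is over all controls $a:[0,\infty)\to\mathbb R^m$ with $a(0)=a$ and $\|a(s_1)-a(s_2)\|_2\le L|s_1-s_2|$ for all $s_1,s_2\ge0$, and $x(\cdot)$ solves $x'(s)=f(x(s),a(s))$, $x(0)=x$. The associated Hamilton--Jacobi--Bellman equation is $$\gamma Q^L-D_xQ^L\cdot f(x,a)-L\|D_aQ^L\|_2-r(x,a)=0\quad\text{in }\mathbb R^n\times\mathbb R^m. \tag{1}$$ Then there is a constant $C$, depending only on $f$, $r$ and $\gamma$ (not on $L,\ell,x,a$), such that for all $L>0$, $\ell>0$ and all $(x,a)\in\mathbb R^n\times\mathbb R^m$ $$0\le Q^{L+\ell}(x,a)-Q^L(x,a)\le\frac{C\ell}{L+\ell},$$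 and for all $L>0$ and all $(x,a)$ $$\limsup_{\ell\to0,\ \ell\ne0}\frac{Q^{L+\ell}(x,a)-Q^L(x,a)}{\ell}\le\frac CL .$$ With the same constant $C$, the two-sided bound also holds when $Q^L$ and $Q^{L+\ell}$ are replaced by any bounded continuous viscosity solutions of (1) with parameters $L$ and $L+\ell$ respectively, and the limsup bound also holds for any family $(Q^L)_{L>0}$ in which each $Q^L$ is a bounded continuous viscosity solution of (1) with parameter $L$. -/

import Mathlib

open Set Filter Topology MeasureTheory
open scoped NNReal

noncomputable section

namespace LipControl

/-- The Euclidean space of dimension `k`. -/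
abbrev Eucl (k : ℕ) : Type := EuclideanSpace ℝ (Fin k)

/-- `g` is Lipschitz with constant `K` for the Euclidean norm of the pair `(x, a)`. -/
def IsLipschitzWith {n m : ℕ} {E : Type*} [NormedAddCommGroup E]
    (K : ℝ≥0) (g : Eucl n → Eucl m → E) : Prop :=
  ∀ (x x' : Eucl n) (a a' : Eucl m),
    ‖g x a - g x' a'‖ ≤ K * Real.sqrt (‖x - x'‖ ^ 2 + ‖a - a'‖ ^ 2)

/-- `g` is bounded on the whole space. -/
def IsBoundedFun {n m : ℕ} {E : Type*} [NormedAddCommGroup E]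
    (g : Eucl n → Eucl m → E) : Prop :=
  ∃ M : ℝ, ∀ (x : Eucl n) (a : Eucl m), ‖g x a‖ ≤ M

/-- `α` is an admissible control starting at `a`: it is `L`-Lipschitz on `[0, ∞)`, `α 0 = a`.
Only the values at nonnegative times matter. -/
structure IsControl {m : ℕ} (L : ℝ) (a : Eucl m) (α : ℝ → Eucl m) : Prop where
  lipschitz : ∀ s t : ℝ, 0 ≤ s → 0 ≤ t → ‖α s - α t‖ ≤ L * |s - t|
  init : α 0 = a

/-- `ξ` solves `ξ' = f(ξ, α)` on `[0, ∞)`, `ξ 0 = x` (one-sided derivative at time zero).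
For continuous `f` and `α` this is the same as being an absolutely continuous solution. -/
structure IsTrajectory {n m : ℕ} (f : Eucl n → Eucl m → Eucl n) (x : Eucl n)
    (α : ℝ → Eucl m) (ξ : ℝ → Eucl n) : Prop where
  init : ξ 0 = x
  deriv : ∀ s : ℝ, 0 ≤ s → HasDerivWithinAt ξ (f (ξ s) (α s)) (Ici 0) s

/-- The discounted reward `∫₀^∞ e^{-γ s} r(ξ(s), α(s)) ds`. -/
def reward {n m : ℕ} (r : Eucl n → Eucl m → ℝ) (γ : ℝ)
    (α : ℝ → Eucl m) (ξ : ℝ → Eucl n) : ℝ :=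
  ∫ s in Ioi (0 : ℝ), Real.exp (-γ * s) * r (ξ s) (α s)

/-- The value function `Q^L(x, a)`: the supremum of the discounted reward over all `L`-Lipschitz
controls starting at `a` and the corresponding trajectories starting at `x`. -/
def valueFun {n m : ℕ} (f : Eucl n → Eucl m → Eucl n) (r : Eucl n → Eucl m → ℝ) (γ L : ℝ)
    (x : Eucl n) (a : Eucl m) : ℝ :=
  sSup {J : ℝ | ∃ (α : ℝ → Eucl m) (ξ : ℝ → Eucl n),
    IsControl L a α ∧ IsTrajectory f x α ξ ∧ J = reward r γ α ξ}

/-- The left-hand side `γ u - D_xφ · f(x,a) - L ‖D_aφ‖ - r(x,a)` of the Hamilton–Jacobi–Bellman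
equation at `(x, a)`, for the value `u` of the unknown and the gradients of a test function. -/
def hjb {n m : ℕ} (f : Eucl n → Eucl m → Eucl n) (r : Eucl n → Eucl m → ℝ) (γ L : ℝ)
    (u : ℝ) (φ : Eucl n × Eucl m → ℝ) (x : Eucl n) (a : Eucl m) : ℝ :=
  γ * u - inner ℝ (gradient (fun y => φ (y, a)) x) (f x a)
    - L * ‖gradient (fun b => φ (x, b)) a‖ - r x a

/-- `u` is a bounded (continuous) viscosity solution on the whole space of
`γ u - D_x u · f(x,a) - L ‖D_a u‖ - r(x,a) = 0`. -/
structure IsBoundedViscositySolution {n m : ℕ} (f : Eucl n → Eucl m → Eucl n)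
    (r : Eucl n → Eucl m → ℝ) (γ L : ℝ) (u : Eucl n → Eucl m → ℝ) : Prop where
  bounded : IsBoundedFun u
  continuous : Continuous fun z : Eucl n × Eucl m => u z.1 z.2
  subsolution : ∀ φ : Eucl n × Eucl m → ℝ, ContDiff ℝ 1 φ → ∀ (x : Eucl n) (a : Eucl m),
    IsLocalMax (fun z : Eucl n × Eucl m => u z.1 z.2 - φ z) (x, a) →
      hjb f r γ L (u x a) φ x a ≤ 0
  supersolution : ∀ φ : Eucl n × Eucl m → ℝ, ContDiff ℝ 1 φ → ∀ (x : Eucl n) (a : Eucl m),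
    IsLocalMin (fun z : Eucl n × Eucl m => u z.1 z.2 - φ z) (x, a) →
      0 ≤ hjb f r γ L (u x a) φ x a

end LipControl

end

/-! The value functions and the viscosity solutions are treated by independent arguments, so
`valueFun` never has to be identified as a solution of the equation.

For value functions, a control with speed `L + ℓ = s L` becomes admissible for `L` when time is
slowed by the factor `s`. In the original clock the state then follows `ζ' = s f(ζ, α)`. Gronwall
keeps `ζ` within `O((s - 1) e^{Kt})` of the old trajectory, and discounting absorbs this growth once
`K < γ`; rescaling the discount also costs `O(s - 1)` (`exists_rescaled_control`). Since `s - 1 = ℓ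
/ L`, this suffices for `ℓ ≤ L`; for `ℓ ≥ L` boundedness of the reward is enough.

For viscosity solutions, the operator is affine in `L`: its value at `L` is the convex combination,
with weights `L / (L + ℓ)` and `ℓ / (L + ℓ)`, of its values at `L + ℓ` and at `0`. Hence a solution
for `L + ℓ` is a subsolution for `L` up to `O(ℓ / (L + ℓ))`, provided the `x`-gradient of test
functions is bounded. Doubling variables with a penalty of fixed slope in `x` ensures that bound
(`sub_le_div_of_subsolution_supersolution`). -/

noncomputable section

namespace LipControl

/-! ### A `C¹` regularization of the norm. -/

section SmoothNorm

variable {E : Type*} [NormedAddCommGroup E]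

/-- A smooth approximation `√(δ² + ‖z‖²)` of the norm. -/
def smoothNorm (δ : ℝ) (z : E) : ℝ := Real.sqrt (δ ^ 2 + ‖z‖ ^ 2)

lemma norm_le_smoothNorm (δ : ℝ) (z : E) : ‖z‖ ≤ smoothNorm δ z :=
  Real.le_sqrt_of_sq_le (by nlinarith [sq_nonneg δ])

lemma smoothNorm_nonneg (δ : ℝ) (z : E) : 0 ≤ smoothNorm δ z := Real.sqrt_nonneg _

lemma smoothNorm_pos {δ : ℝ} (hδ : 0 < δ) (z : E) : 0 < smoothNorm δ z :=
  Real.sqrt_pos.2 (by positivity)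

lemma smoothNorm_zero {δ : ℝ} (hδ : 0 < δ) : smoothNorm δ (0 : E) = δ := by
  simp [smoothNorm, Real.sqrt_sq hδ.le]

lemma smoothNorm_sub_comm (δ : ℝ) (y z : E) : smoothNorm δ (y - z) = smoothNorm δ (z - y) := by
  simp [smoothNorm, norm_sub_rev]

lemma continuous_smoothNorm (δ : ℝ) : Continuous (smoothNorm δ : E → ℝ) := by
  unfold smoothNorm; fun_prop

variable [InnerProductSpace ℝ E]

lemma contDiff_smoothNorm {δ : ℝ} (hδ : 0 < δ) : ContDiff ℝ 1 (smoothNorm δ : E → ℝ) :=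
  (contDiff_const.add (contDiff_norm_sq ℝ)).sqrt fun z => by positivity

/-- This vector is the gradient of `smoothNorm δ`. Its bound does not depend on `δ`, so smoothing at
scale `η` leaves the slope of the penalty under control. -/
lemma norm_inv_smoothNorm_smul_le {δ : ℝ} (hδ : 0 < δ) (z : E) :
    ‖(smoothNorm δ z)⁻¹ • z‖ ≤ 1 := by
  have h := smoothNorm_pos hδ z
  rw [norm_smul, norm_inv, Real.norm_of_nonneg h.le, inv_mul_le_iff₀ h, mul_one]
  exact norm_le_smoothNorm δ z

lemma hasFDerivAt_smoothNorm {δ : ℝ} (hδ : 0 < δ) (z : E) :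
    HasFDerivAt (smoothNorm δ) (innerSL ℝ ((smoothNorm δ z)⁻¹ • z)) z := by
  have h1 : HasFDerivAt (fun w : E => δ ^ 2 + ‖w‖ ^ 2) (2 • innerSL ℝ z) z :=
    ((hasStrictFDerivAt_norm_sq z).hasFDerivAt).const_add _
  have h2 := h1.sqrt (by positivity)
  refine h2.congr_fderiv ?_
  ext w
  have : Real.sqrt (δ ^ 2 + ‖z‖ ^ 2) ≠ 0 := (smoothNorm_pos hδ z).ne'
  simp [smoothNorm]
  field_simp

end SmoothNorm

/-! ### Test functions for the doubling of variables. -/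

section TestFunction

variable {n m : ℕ}

/-- The test function `c ρ_δ(x - y) + e ‖a - b‖² + η (ρ₁(x) + ρ₁(a))` of the variable `(x, a)`,
where `ρ` is the smoothed norm. -/
def doublingTest (c δ e η : ℝ) (y : Eucl n) (b : Eucl m) (z : Eucl n × Eucl m) : ℝ :=
  c * smoothNorm δ (z.1 - y) + e * ‖z.2 - b‖ ^ 2 + η * (smoothNorm 1 z.1 + smoothNorm 1 z.2)

lemma contDiff_doublingTest {δ : ℝ} (hδ : 0 < δ) (c e η : ℝ) (y : Eucl n) (b : Eucl m) :
    ContDiff ℝ 1 (doublingTest c δ e η y b) := by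
  have h1 : ContDiff ℝ 1 fun z : Eucl n × Eucl m => smoothNorm δ (z.1 - y) :=
    (contDiff_smoothNorm hδ).comp (contDiff_fst.sub contDiff_const)
  have h2 : ContDiff ℝ 1 fun z : Eucl n × Eucl m => ‖z.2 - b‖ ^ 2 :=
    (contDiff_norm_sq ℝ).comp (contDiff_snd.sub contDiff_const)
  have h3 : ContDiff ℝ 1 fun z : Eucl n × Eucl m => smoothNorm 1 z.1 :=
    (contDiff_smoothNorm one_pos).comp contDiff_fst
  have h4 : ContDiff ℝ 1 fun z : Eucl n × Eucl m => smoothNorm 1 z.2 :=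
    (contDiff_smoothNorm one_pos).comp contDiff_snd
  exact ((contDiff_const.mul h1).add (contDiff_const.mul h2)).add (contDiff_const.mul (h3.add h4))

lemma gradient_doublingTest_fst {δ : ℝ} (hδ : 0 < δ) (c e η : ℝ) (y : Eucl n) (b : Eucl m)
    (x : Eucl n) (a : Eucl m) :
    gradient (fun w => doublingTest c δ e η y b (w, a)) x =
      c • ((smoothNorm δ (x - y))⁻¹ • (x - y)) + η • ((smoothNorm 1 x)⁻¹ • x) := by
  apply HasGradientAt.gradient
  rw [hasGradientAt_iff_hasFDerivAt]
  have h1 := HasFDerivAt.comp (f := fun w : Eucl n => w - y) x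
    (hasFDerivAt_smoothNorm hδ (x - y)) ((hasFDerivAt_id x).sub_const y)
  have h2 := hasFDerivAt_smoothNorm one_pos x
  have h3 := ((h1.const_mul c).add_const (e * ‖a - b‖ ^ 2)).add
    ((h2.add_const (smoothNorm 1 a)).const_mul η)
  refine h3.congr_fderiv ?_
  ext w
  simp

lemma gradient_doublingTest_snd (c δ e η : ℝ) (y : Eucl n) (b : Eucl m)
    (x : Eucl n) (a : Eucl m) :
    gradient (fun w => doublingTest c δ e η y b (x, w)) a =
      (2 * e) • (a - b) + η • ((smoothNorm 1 a)⁻¹ • a) := by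
  apply HasGradientAt.gradient
  rw [hasGradientAt_iff_hasFDerivAt]
  have h1 := HasFDerivAt.comp (f := fun w : Eucl m => w - b) a
    (hasStrictFDerivAt_norm_sq (a - b)).hasFDerivAt ((hasFDerivAt_id a).sub_const b)
  have h2 := hasFDerivAt_smoothNorm one_pos a
  have h3 := ((h1.const_mul e).const_add (c * smoothNorm δ (x - y))).add
    ((h2.const_add (smoothNorm 1 x)).const_mul η)
  refine h3.congr_fderiv ?_
  ext w
  simp
  ring

end TestFunction

/-! ### Comparison principle. -/

section Comparison

variable {n m : ℕ} {f : Eucl n → Eucl m → Eucl n} {r : Eucl n → Eucl m → ℝ}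

lemma sqrt_sq_add_sq_le {s t : ℝ} (hs : 0 ≤ s) (ht : 0 ≤ t) :
    Real.sqrt (s ^ 2 + t ^ 2) ≤ s + t :=
  Real.sqrt_le_iff.2 ⟨by positivity, by nlinarith [mul_nonneg hs ht]⟩

lemma IsLipschitzWith.norm_sub_le {E : Type*} [NormedAddCommGroup E] {K : ℝ≥0}
    {g : Eucl n → Eucl m → E} (hg : IsLipschitzWith K g) (x x' : Eucl n) (a a' : Eucl m) :
    ‖g x a - g x' a'‖ ≤ K * (‖x - x'‖ + ‖a - a'‖) :=
  (hg x x' a a').trans <| mul_le_mul_of_nonneg_left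
    (sqrt_sq_add_sq_le (norm_nonneg _) (norm_nonneg _)) K.2

/-- The penalized difference used in the doubling of variables attains its maximum. -/
lemma exists_max_doubling {u v : Eucl n → Eucl m → ℝ}
    (hu : IsBoundedFun u) (huc : Continuous fun z : Eucl n × Eucl m => u z.1 z.2)
    (hv : IsBoundedFun v) (hvc : Continuous fun z : Eucl n × Eucl m => v z.1 z.2)
    {K δ e η : ℝ} (hK : 0 < K) (he : 0 < e) (hη : 0 < η) :
    ∃ (x : Eucl n) (a : Eucl m) (y : Eucl n) (b : Eucl m), ∀ x' a' y' b',
      u x' a' - v y' b' - doublingTest K δ e η y' b' (x', a') ≤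
        u x a - v y b - doublingTest K δ e η y b (x, a) := by
  obtain ⟨Mu, hMu⟩ := hu
  obtain ⟨Mv, hMv⟩ := hv
  let Φ : (Eucl n × Eucl m) × (Eucl n × Eucl m) → ℝ := fun z =>
    u z.1.1 z.1.2 - v z.2.1 z.2.2 - doublingTest K δ e η z.2.1 z.2.2 z.1
  have hΦ : Continuous Φ := by
    have h1 : Continuous fun z : (Eucl n × Eucl m) × (Eucl n × Eucl m) => u z.1.1 z.1.2 :=
      huc.comp continuous_fst
    have h2 : Continuous fun z : (Eucl n × Eucl m) × (Eucl n × Eucl m) => v z.2.1 z.2.2 :=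
      hvc.comp continuous_snd
    refine (h1.sub h2).sub ?_
    have c1 := continuous_smoothNorm (E := Eucl n) δ
    have c2 := continuous_smoothNorm (E := Eucl n) 1
    have c3 := continuous_smoothNorm (E := Eucl m) 1
    unfold doublingTest
    fun_prop
  -- A common coercivity rate for all penalties. The factor 2 before `c` is there because `x` and
  -- `a` also have to control `y` and `b` through the differences.
  obtain ⟨c, hc0, hcK, hce, hcη⟩ : ∃ c : ℝ, 0 < c ∧ c ≤ K ∧ c ≤ e ∧ 2 * c ≤ η :=
    ⟨min (min K e) (η / 2), by positivity, (min_le_left _ _).trans (min_le_left _ _),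
      (min_le_left _ _).trans (min_le_right _ _), by
        have := min_le_right (min K e) (η / 2); linarith⟩
  have hbound : ∀ z, Φ z ≤ Mu + Mv + c - c * ‖z‖ := by
    rintro ⟨⟨x, a⟩, ⟨y, b⟩⟩
    have hz : ‖((x, a), (y, b))‖ ≤ 2 * ‖x‖ + 2 * ‖a‖ + ‖x - y‖ + ‖a - b‖ := by
      have h1 : ‖y‖ ≤ ‖x‖ + ‖x - y‖ := by
        have := norm_sub_norm_le y x; rw [norm_sub_rev] at this; linarith
      have h2 : ‖b‖ ≤ ‖a‖ + ‖a - b‖ := by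
        have := norm_sub_norm_le b a; rw [norm_sub_rev] at this; linarith
      have := norm_nonneg x
      have := norm_nonneg a
      have := norm_nonneg (x - y)
      have := norm_nonneg (a - b)
      simp only [Prod.norm_def]
      refine max_le (max_le ?_ ?_) (max_le ?_ ?_) <;> linarith
    have hux := (le_abs_self _).trans (hMu x a)
    have hvy := (neg_abs_le _).trans' (neg_le_neg (hMv y b))
    have hxy : c * ‖x - y‖ ≤ K * smoothNorm δ (x - y) :=
      mul_le_mul hcK (norm_le_smoothNorm _ _) (norm_nonneg _) hK.le
    have hab : c * ‖a - b‖ - c ≤ e * ‖a - b‖ ^ 2 := by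
      have h3 : c * ‖a - b‖ ^ 2 ≤ e * ‖a - b‖ ^ 2 :=
        mul_le_mul_of_nonneg_right hce (sq_nonneg _)
      have h4 : ‖a - b‖ - 1 ≤ ‖a - b‖ ^ 2 := by nlinarith [sq_nonneg (‖a - b‖ - 1), norm_nonneg (a - b)]
      nlinarith
    have hx : 2 * c * ‖x‖ ≤ η * smoothNorm 1 x :=
      mul_le_mul hcη (norm_le_smoothNorm _ _) (norm_nonneg _) hη.le
    have ha : 2 * c * ‖a‖ ≤ η * smoothNorm 1 a :=
      mul_le_mul hcη (norm_le_smoothNorm _ _) (norm_nonneg _) hη.le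
    have hcz := mul_le_mul_of_nonneg_left hz hc0.le
    simp only [Φ, doublingTest]
    linarith
  have hev : ∀ᶠ z in cocompact ((Eucl n × Eucl m) × (Eucl n × Eucl m)), Φ z ≤ Φ 0 := by
    have ht := tendsto_norm_cocompact_atTop (E := (Eucl n × Eucl m) × (Eucl n × Eucl m))
    filter_upwards [ht.eventually_ge_atTop ((Mu + Mv + c - Φ 0) / c)] with z hz
    rw [div_le_iff₀ hc0] at hz
    linarith [hbound z]
  obtain ⟨z, hz⟩ := hΦ.exists_forall_ge' 0 hev
  exact ⟨z.1.1, z.1.2, z.2.1, z.2.2, fun x' a' y' b' => hz ((x', a'), (y', b'))⟩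

/-- Comparison of a perturbed subsolution with a supersolution. The subsolution inequality is only
needed for test functions with a bounded gradient in the first variable. -/
theorem sub_le_div_of_subsolution_supersolution {Kf Kr : ℝ≥0} {γ L D K : ℝ}
    (hf_bdd : IsBoundedFun f) (hf_lip : IsLipschitzWith Kf f) (hr_lip : IsLipschitzWith Kr r)
    (hγ : 0 < γ) (hL : 0 ≤ L) (hK : 0 < K) (hKγ : K * Kf + Kr ≤ γ * K)
    {u v : Eucl n → Eucl m → ℝ}
    (hu : IsBoundedFun u) (huc : Continuous fun z : Eucl n × Eucl m => u z.1 z.2)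
    (hv : IsBoundedFun v) (hvc : Continuous fun z : Eucl n × Eucl m => v z.1 z.2)
    (hsub : ∀ φ : Eucl n × Eucl m → ℝ, ContDiff ℝ 1 φ → ∀ (x : Eucl n) (a : Eucl m),
      IsLocalMax (fun z : Eucl n × Eucl m => u z.1 z.2 - φ z) (x, a) →
      ‖gradient (fun y => φ (y, a)) x‖ ≤ K + 1 → hjb f r γ L (u x a) φ x a ≤ D)
    (hsup : ∀ φ : Eucl n × Eucl m → ℝ, ContDiff ℝ 1 φ → ∀ (x : Eucl n) (a : Eucl m),
      IsLocalMin (fun z : Eucl n × Eucl m => v z.1 z.2 - φ z) (x, a) →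
      0 ≤ hjb f r γ L (v x a) φ x a) (x₀ : Eucl n) (a₀ : Eucl m) :
    u x₀ a₀ - v x₀ a₀ ≤ D / γ := by
  obtain ⟨Mf, hMf⟩ := hf_bdd
  -- The error is `η` times a constant independent of the maximum point, so no convergence of
  -- maximum points is needed.
  have key : ∀ η : ℝ, 0 < η → η ≤ 1 → γ * (u x₀ a₀ - v x₀ a₀) ≤
      D + η * (Mf + L + γ * K + γ * (smoothNorm 1 x₀ + smoothNorm 1 a₀)
        + (γ * K) ^ 2 / (4 * γ)) := by
    intro η hη hη1
    obtain ⟨x, a, y, b, hmax⟩ := exists_max_doubling (δ := η) hu huc hv hvc hK (inv_pos.2 hη) hη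
    have hp1 : ‖(smoothNorm η (x - y))⁻¹ • (x - y)‖ ≤ 1 := norm_inv_smoothNorm_smul_le hη _
    have hpx : ‖(smoothNorm 1 x)⁻¹ • x‖ ≤ 1 := norm_inv_smoothNorm_smul_le one_pos _
    have hpa : ‖(smoothNorm 1 a)⁻¹ • a‖ ≤ 1 := norm_inv_smoothNorm_smul_le one_pos _
    have h1 := hsub (doublingTest K η η⁻¹ η y b) (contDiff_doublingTest hη _ _ _ _ _) x a
      (Eventually.of_forall fun z => by have := hmax z.1 z.2 y b; dsimp only; linarith) (by
        rw [gradient_doublingTest_fst hη]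
        refine (norm_add_le _ _).trans ?_
        rw [norm_smul K, norm_smul η, Real.norm_of_nonneg hK.le, Real.norm_of_nonneg hη.le]
        nlinarith)
    -- The confinement weight is `0` here because the confining term involves only `(x, a)`. Both
    -- test gradients therefore agree up to `O(η)`.
    have h2 := hsup (doublingTest (-K) η (-η⁻¹) 0 x a) (contDiff_doublingTest hη _ _ _ _ _) y b
      (Eventually.of_forall fun z => by
        have := hmax x a z.1 z.2
        simp only [doublingTest] at this ⊢
        rw [smoothNorm_sub_comm η z.1, smoothNorm_sub_comm η y, norm_sub_rev z.2, norm_sub_rev b]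
        linarith)
    simp only [hjb, gradient_doublingTest_fst hη, gradient_doublingTest_snd] at h1 h2
    rw [smoothNorm_sub_comm η y x, ← neg_sub x y, ← neg_sub a b] at h2
    simp only [smul_neg, neg_smul, neg_neg, zero_smul, add_zero, mul_neg] at h2
    set p := (smoothNorm η (x - y))⁻¹ • (x - y)
    set px := (smoothNorm 1 x)⁻¹ • x
    set pa := (smoothNorm 1 a)⁻¹ • a
    set q := (2 * η⁻¹) • (a - b)
    rw [inner_add_left, real_inner_smul_left p, real_inner_smul_left px] at h1
    rw [real_inner_smul_left p] at h2
    have hq : ‖q + η • pa‖ ≤ ‖q‖ + η := by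
      refine (norm_add_le _ _).trans ?_
      rw [norm_smul η, Real.norm_of_nonneg hη.le]
      nlinarith
    have hpf : inner ℝ p (f x a) - inner ℝ p (f y b) ≤ Kf * (‖x - y‖ + ‖a - b‖) := by
      rw [← inner_sub_right]
      refine (real_inner_le_norm _ _).trans ?_
      have := hf_lip.norm_sub_le x y a b
      nlinarith [norm_nonneg (f x a - f y b), norm_nonneg p]
    have hpxf : inner ℝ px (f x a) ≤ Mf := by
      refine (real_inner_le_norm _ _).trans ?_
      nlinarith [norm_nonneg (f x a), norm_nonneg px, hMf x a]
    have hrr : r x a - r y b ≤ Kr * (‖x - y‖ + ‖a - b‖) :=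
      (le_abs_self _).trans (hr_lip.norm_sub_le x y a b)
    -- Comparing the maximum with a diagonal point brings in the value at `(x₀, a₀)`.
    have hd := hmax x₀ a₀ x₀ a₀
    simp only [doublingTest, sub_self, smoothNorm_zero hη, norm_zero] at hd
    have hsx := smoothNorm_nonneg 1 x
    have hsa := smoothNorm_nonneg 1 a
    have hρ := norm_le_smoothNorm η (x - y)
    have hs := norm_nonneg (x - y)
    have ht := norm_nonneg (a - b)
    have hLq := mul_le_mul_of_nonneg_left hq hL
    have hKpf := mul_le_mul_of_nonneg_left hpf hK.le
    have hηpx := mul_le_mul_of_nonneg_left hpxf hη.le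
    -- The errors from varying `f` and `r` are at most `γ K (‖x - y‖ + ‖a - b‖)`. The `x` part
    -- cancels exactly against the linear penalty, the `a` part against the quadratic one by
    -- `hamgm`.
    have hA := mul_le_mul_of_nonneg_right hKγ (add_nonneg hs ht)
    have huv : γ * (u x a - v y b) ≤ D + γ * K * (‖x - y‖ + ‖a - b‖) + η * (Mf + L) := by
      linarith
    have hamgm : γ * K * ‖a - b‖ - γ * (η⁻¹ * ‖a - b‖ ^ 2) ≤ η * ((γ * K) ^ 2 / (4 * γ)) := by
      have : η * ((γ * K) ^ 2 / (4 * γ)) - (γ * K * ‖a - b‖ - γ * (η⁻¹ * ‖a - b‖ ^ 2))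
          = γ * η⁻¹ * (‖a - b‖ - η * K / 2) ^ 2 := by field_simp; ring
      have : 0 ≤ γ * η⁻¹ * (‖a - b‖ - η * K / 2) ^ 2 := by positivity
      linarith
    have hpen : u x₀ a₀ - v x₀ a₀ ≤ u x a - v y b - K * ‖x - y‖ - η⁻¹ * ‖a - b‖ ^ 2 +
        η * K + η * (smoothNorm 1 x₀ + smoothNorm 1 a₀) := by
      have e1 := mul_le_mul_of_nonneg_left hρ hK.le
      have e2 := mul_nonneg hη.le (add_nonneg hsx hsa)
      linarith
    have := mul_le_mul_of_nonneg_left hpen hγ.le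
    linarith
  rw [le_div_iff₀ hγ, mul_comm]
  set C := Mf + L + γ * K + γ * (smoothNorm 1 x₀ + smoothNorm 1 a₀) + (γ * K) ^ 2 / (4 * γ)
  have ht : Tendsto (fun η : ℝ => D + η * C) (𝓝[>] 0) (𝓝 D) := by
    have : Tendsto (fun η : ℝ => D + η * C) (𝓝 0) (𝓝 (D + 0 * C)) :=
      Continuous.tendsto (by fun_prop) 0
    rw [zero_mul, add_zero] at this
    exact this.mono_left nhdsWithin_le_nhds
  refine ge_of_tendsto ht ?_
  filter_upwards [Ioc_mem_nhdsGT (zero_lt_one' ℝ)] with η hη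
  exact key η hη.1 hη.2

lemma hjb_mono {γ L L' u : ℝ} (h : L ≤ L') (φ : Eucl n × Eucl m → ℝ) (x : Eucl n) (a : Eucl m) :
    hjb f r γ L' u φ x a ≤ hjb f r γ L u φ x a := by
  have := mul_le_mul_of_nonneg_right h (norm_nonneg (gradient (fun b => φ (x, b)) a))
  simp only [hjb]
  linarith

/-- Constants above `sup r / γ` are supersolutions. -/
lemma hjb_const_nonneg {γ L c : ℝ} (hc : ∀ x a, r x a ≤ γ * c) (φ : Eucl n × Eucl m → ℝ)
    (x : Eucl n) (a : Eucl m) (h : IsLocalMin (fun z : Eucl n × Eucl m => c - φ z) (x, a)) :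
    0 ≤ hjb f r γ L c φ x a := by
  have hφ : IsLocalMax φ (x, a) := by
    filter_upwards [h] with z hz
    linarith
  have h1 : IsLocalMax (fun y => φ (y, a)) x :=
    hφ.comp_continuous (g := fun y => (y, a)) (Continuous.continuousAt (by fun_prop))
  have h2 : IsLocalMax (fun b => φ (x, b)) a :=
    hφ.comp_continuous (g := fun b => (x, b)) (Continuous.continuousAt (by fun_prop))
  simp only [hjb, gradient, h1.fderiv_eq_zero, h2.fderiv_eq_zero, map_zero, inner_zero_left,
    norm_zero]
  linarith [hc x a]

/-- Quantitative monotonicity in `L` of bounded viscosity solutions. -/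
theorem IsBoundedViscositySolution.sub_bounds {Kf Kr : ℝ≥0} {γ Mf Mr K : ℝ}
    (hMf : ∀ x a, ‖f x a‖ ≤ Mf) (hMr : ∀ x a, ‖r x a‖ ≤ Mr)
    (hf_lip : IsLipschitzWith Kf f) (hr_lip : IsLipschitzWith Kr r)
    (hγ : 0 < γ) (hK : 0 < K) (hKγ : K * Kf + Kr ≤ γ * K)
    {L ℓ : ℝ} (hL : 0 < L) (hℓ : 0 < ℓ) {u v : Eucl n → Eucl m → ℝ}
    (hu : IsBoundedViscositySolution f r γ L u)
    (hv : IsBoundedViscositySolution f r γ (L + ℓ) v) (x : Eucl n) (a : Eucl m) :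
    0 ≤ v x a - u x a ∧
      v x a - u x a ≤ (2 * Mr + (K + 1) * Mf) / γ * ℓ / (L + ℓ) := by
  have hLℓ : 0 < L + ℓ := by positivity
  constructor
  · have := sub_le_div_of_subsolution_supersolution (D := 0) ⟨Mf, hMf⟩ hf_lip hr_lip hγ hLℓ.le hK hKγ
      hu.bounded hu.continuous hv.bounded hv.continuous
      (fun φ hφ x a h _ => (hjb_mono (by linarith) φ x a).trans (hu.subsolution φ hφ x a h))
      hv.supersolution x a
    rw [zero_div] at this
    linarith
  -- Comparison with the constant `Mr / γ` gives a bound independent of the a priori bound of `v`,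
  -- as a uniform constant requires.
  · have hvM : ∀ x a, γ * v x a ≤ Mr := by
      intro x a
      have := sub_le_div_of_subsolution_supersolution (D := 0) (v := fun _ _ => Mr / γ) ⟨Mf, hMf⟩
        hf_lip hr_lip hγ hLℓ.le hK hKγ hv.bounded hv.continuous ⟨‖Mr / γ‖, fun _ _ => le_rfl⟩
        continuous_const (fun φ hφ x a h _ => hv.subsolution φ hφ x a h)
        (fun φ _ x a h => hjb_const_nonneg (fun x a => by
          rw [mul_div_cancel₀ _ hγ.ne']; exact (le_abs_self _).trans (hMr x a)) φ x a h) x a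
      rw [zero_div, sub_nonpos, le_div_iff₀ hγ] at this
      linarith
    have hvu := sub_le_div_of_subsolution_supersolution (D := ℓ / (L + ℓ) * (2 * Mr + (K + 1) * Mf))
      ⟨Mf, hMf⟩ hf_lip hr_lip hγ hL.le hK hKγ hv.bounded hv.continuous hu.bounded hu.continuous
      (fun φ hφ x a h hg => by
        have h1 := hv.subsolution φ hφ x a h
        simp only [hjb] at h1 ⊢
        set p := gradient (fun y => φ (y, a)) x
        set q := gradient (fun b => φ (x, b)) a
        have hpf : -((K + 1) * Mf) ≤ inner ℝ p (f x a) := by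
          have e1 := (abs_le.1 (abs_real_inner_le_norm p (f x a))).1
          have e2 := mul_le_mul hg (hMf x a) (norm_nonneg _) (by positivity)
          linarith
        have hr := (abs_le.1 (hMr x a)).1
        -- The convex combination in `L`, cleared of denominators. The `ℓ` term no longer contains
        -- `‖q‖`, so no bound on the `a`-gradient is needed.
        have e3 : (L + ℓ) * (γ * v x a - inner ℝ p (f x a) - L * ‖q‖ - r x a) =
            L * (γ * v x a - inner ℝ p (f x a) - (L + ℓ) * ‖q‖ - r x a) +
            ℓ * (γ * v x a - inner ℝ p (f x a) - r x a) := by ring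
        have e4 : ℓ * (γ * v x a - inner ℝ p (f x a) - r x a) ≤
            ℓ * (2 * Mr + (K + 1) * Mf) :=
          mul_le_mul_of_nonneg_left (by linarith [hvM x a]) hℓ.le
        have e5 := mul_nonpos_of_nonneg_of_nonpos hL.le h1
        rw [div_mul_eq_mul_div, le_div_iff₀ hLℓ]
        linarith)
      hu.supersolution x a
    refine hvu.trans (le_of_eq ?_)
    field_simp

end Comparison

/-! ### Global solutions of ordinary differential equations. -/

section GlobalSolution

/-- Global existence for the initial value problem `ξ' = v(t, ξ)` with a bounded field that is
Lipschitz in the state and continuous in time. -/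
theorem exists_global_solution {E : Type*} [NormedAddCommGroup E] [NormedSpace ℝ E]
    [CompleteSpace E] {v : ℝ → E → E} {K : ℝ≥0} {M : ℝ} (hlip : ∀ t, LipschitzWith K (v t))
    (hcont : ∀ x, ContinuousOn (fun t => v t x) (Ici 0)) (hbdd : ∀ t x, ‖v t x‖ ≤ M) (x₀ : E) :
    ∃ ξ : ℝ → E, ξ 0 = x₀ ∧ ∀ s : ℝ, 0 ≤ s → HasDerivWithinAt ξ (v s (ξ s)) (Ici 0) s := by
  have hex : ∀ N : ℕ, ∃ ξ : ℝ → E, ξ 0 = x₀ ∧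
      ∀ t ∈ Icc (0 : ℝ) N, HasDerivWithinAt ξ (v t (ξ t)) (Icc 0 (N : ℝ)) t := by
    intro N
    -- A field bounded by `M` moves a point by at most `M N` in time `N`; with this radius
    -- Picard–Lindelöf covers all of `[0, N]`.
    have hPL : IsPicardLindelof v (tmin := 0) (tmax := (N : ℝ)) ⟨0, le_rfl, N.cast_nonneg⟩ x₀
        (M.toNNReal * N) 0 M.toNNReal K :=
      { lipschitzOnWith := fun t _ => (hlip t).lipschitzOnWith
        continuousOn := fun x _ => (hcont x).mono Icc_subset_Ici_self
        norm_le := fun t _ x _ => (hbdd t x).trans (Real.le_coe_toNNReal M)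
        mul_max_le := by simp }
    exact hPL.exists_eq_forall_mem_Icc_hasDerivWithinAt₀
  choose ξ hξ0 hξ using hex
  have hagree : ∀ N N' : ℕ, N ≤ N' → EqOn (ξ N) (ξ N') (Icc 0 (N : ℝ)) := by
    intro N N' h
    have hNN : (N : ℝ) ≤ N' := by exact_mod_cast h
    have hr : ∀ k : ℕ, (N : ℝ) ≤ k → ∀ t ∈ Ico (0 : ℝ) N,
        HasDerivWithinAt (ξ k) (v t (ξ k t)) (Ici t) t := fun k hk t ht =>
      (hξ k t ⟨ht.1, ht.2.le.trans hk⟩).mono_of_mem_nhdsWithin <|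
        mem_of_superset (Icc_mem_nhdsGE (ht.2.trans_le hk)) (Icc_subset_Icc_left ht.1)
    have hc : ∀ k : ℕ, (N : ℝ) ≤ k → ContinuousOn (ξ k) (Icc 0 (N : ℝ)) := fun k hk t ht =>
      (hξ k t ⟨ht.1, ht.2.trans hk⟩).continuousWithinAt.mono (Icc_subset_Icc_right hk)
    exact ODE_solution_unique hlip (hc N le_rfl) (hr N le_rfl) (hc N' hNN) (hr N' hNN)
      ((hξ0 N).trans (hξ0 N').symm)
  have hagree' : ∀ (N N' : ℕ) (t : ℝ), 0 ≤ t → t ≤ N → t ≤ N' → ξ N t = ξ N' t := by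
    intro N N' t h0 h1 h2
    rcases le_total N N' with h | h
    · exact hagree N N' h ⟨h0, h1⟩
    · exact (hagree N' N h ⟨h0, h2⟩).symm
  have heq : ∀ (N : ℕ) (t : ℝ), 0 ≤ t → t ≤ N → ξ ⌈t⌉₊ t = ξ N t := fun N t h0 h1 =>
    hagree' _ _ t h0 (Nat.le_ceil t) h1
  refine ⟨fun t => ξ ⌈t⌉₊ t, by simpa using hξ0 0, fun s hs => ?_⟩
  obtain ⟨N, hN⟩ := exists_nat_gt s
  have hmem : Icc 0 (N : ℝ) ∈ 𝓝[Ici 0] s := by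
    rw [← Ici_inter_Iic]
    exact inter_mem self_mem_nhdsWithin (mem_nhdsWithin_of_mem_nhds (Iic_mem_nhds hN))
  have hd := (hξ N s ⟨hs, hN.le⟩).mono_of_mem_nhdsWithin hmem
  simp only [heq N s hs hN.le]
  refine hd.congr_of_eventuallyEq ?_ (heq N s hs hN.le)
  filter_upwards [hmem] with t ht
  exact heq N t ht.1 ht.2

end GlobalSolution

/-! ### Value functions and time rescaling. -/

section ValueFunction

variable {n m : ℕ} {f : Eucl n → Eucl m → Eucl n} {r : Eucl n → Eucl m → ℝ}

lemma IsLipschitzWith.lipschitzWith_left {K : ℝ≥0} (hf : IsLipschitzWith K f) (a : Eucl m) :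
    LipschitzWith K fun x => f x a :=
  LipschitzWith.of_dist_le_mul fun x y => by
    simpa [dist_eq_norm] using hf.norm_sub_le x y a a

lemma IsLipschitzWith.continuous {E : Type*} [NormedAddCommGroup E] {K : ℝ≥0}
    {g : Eucl n → Eucl m → E} (hg : IsLipschitzWith K g) :
    Continuous fun z : Eucl n × Eucl m => g z.1 z.2 := by
  refine LipschitzWith.continuous (K := K * 2) (LipschitzWith.of_dist_le_mul fun z w => ?_)
  rw [dist_eq_norm, dist_eq_norm, NNReal.coe_mul, mul_assoc]
  refine (hg.norm_sub_le _ _ _ _).trans (mul_le_mul_of_nonneg_left ?_ K.2)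
  have h1 := norm_fst_le (z - w)
  have h2 := norm_snd_le (z - w)
  simp only [Prod.fst_sub, Prod.snd_sub] at h1 h2
  push_cast
  linarith

lemma IsControl.continuousOn {L : ℝ} {a : Eucl m} {α : ℝ → Eucl m} (h : IsControl L a α) :
    ContinuousOn α (Ici 0) := by
  refine LipschitzOnWith.continuousOn (K := L.toNNReal)
    (LipschitzOnWith.of_dist_le_mul fun s hs t ht => ?_)
  rw [dist_eq_norm, Real.dist_eq]
  exact (h.lipschitz s t hs ht).trans
    (mul_le_mul_of_nonneg_right (Real.le_coe_toNNReal L) (abs_nonneg _))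

lemma IsTrajectory.continuousOn {x : Eucl n} {α : ℝ → Eucl m} {ξ : ℝ → Eucl n}
    (h : IsTrajectory f x α ξ) : ContinuousOn ξ (Ici 0) :=
  fun s hs => (h.deriv s hs).continuousWithinAt

/-- The trajectories of a multiple of `f` along a given continuous control exist. -/
lemma exists_solution_smul {Kf : ℝ≥0} (hf_bdd : IsBoundedFun f) (hf_lip : IsLipschitzWith Kf f)
    {α : ℝ → Eucl m} (hα : ContinuousOn α (Ici 0)) (c : ℝ) (x : Eucl n) :
    ∃ ξ : ℝ → Eucl n, ξ 0 = x ∧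
      ∀ s : ℝ, 0 ≤ s → HasDerivWithinAt ξ (c • f (ξ s) (α s)) (Ici 0) s := by
  obtain ⟨M, hM⟩ := hf_bdd
  refine exists_global_solution (v := fun t y => c • f y (α t)) (K := ‖c‖₊ * Kf) (M := ‖c‖ * M)
    (fun t => ?_) (fun y => ?_) (fun t y => ?_) x
  · exact (lipschitzWith_smul c).comp (hf_lip.lipschitzWith_left (α t))
  · exact (hf_lip.continuous.comp_continuousOn (continuousOn_const.prodMk hα)).const_smul c
  · rw [norm_smul]
    exact mul_le_mul_of_nonneg_left (hM _ _) (norm_nonneg _)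

lemma exists_trajectory {Kf : ℝ≥0} (hf_bdd : IsBoundedFun f) (hf_lip : IsLipschitzWith Kf f)
    {α : ℝ → Eucl m} (hα : ContinuousOn α (Ici 0)) (x : Eucl n) :
    ∃ ξ : ℝ → Eucl n, IsTrajectory f x α ξ := by
  obtain ⟨ξ, h0, h⟩ := exists_solution_smul hf_bdd hf_lip hα 1 x
  exact ⟨ξ, h0, by simpa using h⟩

lemma integrableOn_discounted {Kr : ℝ≥0} {Mr c : ℝ} (hMr : ∀ x a, ‖r x a‖ ≤ Mr)
    (hr_lip : IsLipschitzWith Kr r) (hc : 0 < c) {α : ℝ → Eucl m} {ξ : ℝ → Eucl n}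
    (hα : ContinuousOn α (Ici 0)) (hξ : ContinuousOn ξ (Ici 0)) :
    IntegrableOn (fun s : ℝ => Real.exp (-c * s) * r (ξ s) (α s)) (Ioi 0) := by
  refine Integrable.mono' ((integrableOn_exp_mul_Ioi (neg_neg_of_pos hc) 0).mul_const Mr) ?_
    (Eventually.of_forall fun s => ?_)
  · refine ContinuousOn.aestronglyMeasurable ?_ measurableSet_Ioi
    refine ContinuousOn.mul (by fun_prop) ?_
    exact (hr_lip.continuous.comp_continuousOn (hξ.prodMk hα)).mono Ioi_subset_Ici_self
  · rw [norm_mul, Real.norm_of_nonneg (Real.exp_nonneg _)]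
    exact mul_le_mul_of_nonneg_left (hMr _ _) (Real.exp_nonneg _)

lemma integral_exp_neg_mul_Ioi_zero {c : ℝ} (hc : 0 < c) :
    ∫ s in Ioi (0 : ℝ), Real.exp (-c * s) = 1 / c := by
  rw [integral_exp_mul_Ioi (neg_neg_of_pos hc)]
  simp

lemma abs_reward_le {Mr γ : ℝ} (hMr : ∀ x a, ‖r x a‖ ≤ Mr) (hγ : 0 < γ)
    (α : ℝ → Eucl m) (ξ : ℝ → Eucl n) : |reward r γ α ξ| ≤ Mr / γ := by
  have h := norm_integral_le_of_norm_le (μ := volume.restrict (Ioi (0 : ℝ)))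
    (f := fun s : ℝ => Real.exp (-γ * s) * r (ξ s) (α s))
    ((integrableOn_exp_mul_Ioi (neg_neg_of_pos hγ) 0).mul_const Mr)
    (Eventually.of_forall fun s => by
      rw [norm_mul, Real.norm_of_nonneg (Real.exp_nonneg _)]
      exact mul_le_mul_of_nonneg_left (hMr _ _) (Real.exp_nonneg _))
  rwa [integral_mul_const, integral_exp_neg_mul_Ioi_zero hγ, one_div_mul_eq_div] at h

/-- Speeding up the dynamics by a factor `s` moves the trajectory by a multiple of `s - 1`. -/
lemma norm_sub_le_of_rescaled {Kf K : ℝ≥0} {Mf s : ℝ} (hMf : ∀ x a, ‖f x a‖ ≤ Mf)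
    (hf_lip : IsLipschitzWith Kf f) (hKf : Kf ≤ K) (hK : 0 < K) (hs : 1 ≤ s) {x : Eucl n}
    {α : ℝ → Eucl m} {ξ ζ : ℝ → Eucl n} (hξ : IsTrajectory f x α ξ) (hζ0 : ζ 0 = x)
    (hζ : ∀ t : ℝ, 0 ≤ t → HasDerivWithinAt ζ (s • f (ζ t) (α t)) (Ici 0) t) {t : ℝ}
    (ht : 0 ≤ t) : ‖ξ t - ζ t‖ ≤ (s - 1) * (Mf / K) * Real.exp (K * t) := by
  have hMf0 : 0 ≤ Mf := (norm_nonneg _).trans (hMf 0 0)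
  have hζc : ContinuousOn ζ (Ici 0) := fun t ht => (hζ t ht).continuousWithinAt
  -- `ζ` is an approximate solution of the unscaled equation, with defect at most `(s - 1) * Mf`.
  have h := dist_le_of_approx_trajectories_ODE (v := fun t y => f y (α t)) (K := K) (a := 0)
    (b := t) (δ := 0) (εf := 0) (εg := (s - 1) * Mf)
    (fun t => (hf_lip.lipschitzWith_left (α t)).weaken hKf)
    (hξ.continuousOn.mono Icc_subset_Ici_self)
    (fun τ hτ => (hξ.deriv τ hτ.1).mono (Ici_subset_Ici.2 hτ.1))
    (fun τ _ => (dist_self _).le)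
    (hζc.mono Icc_subset_Ici_self)
    (fun τ hτ => (hζ τ hτ.1).mono (Ici_subset_Ici.2 hτ.1))
    (fun τ _ => by
      have : s • f (ζ τ) (α τ) - f (ζ τ) (α τ) = (s - 1) • f (ζ τ) (α τ) := by
        rw [sub_smul, one_smul]
      rw [dist_eq_norm, this, norm_smul, Real.norm_of_nonneg (by linarith)]
      exact mul_le_mul_of_nonneg_left (hMf _ _) (by linarith))
    (by rw [hξ.init, hζ0, dist_self]) t ⟨ht, le_rfl⟩
  have hK' : (0 : ℝ) < K := hK
  rw [dist_eq_norm, gronwallBound_of_K_ne_0 hK'.ne', zero_add, sub_zero] at h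
  simp only [zero_mul, zero_add] at h
  refine h.trans ?_
  rw [mul_div_assoc]
  exact mul_le_mul_of_nonneg_left (by linarith)
    (mul_nonneg (by linarith) (div_nonneg hMf0 hK'.le))

/-- Slowing a control down by a factor `s` costs at most a multiple of `s - 1`. -/
theorem exists_rescaled_control {Kf Kr K : ℝ≥0} {γ Mf Mr s L : ℝ} (hMf : ∀ x a, ‖f x a‖ ≤ Mf)
    (hMr : ∀ x a, ‖r x a‖ ≤ Mr) (hf_lip : IsLipschitzWith Kf f) (hr_lip : IsLipschitzWith Kr r)
    (hKf : Kf ≤ K) (hK : 0 < K) (hKγ : K < γ) (hs : 1 ≤ s) {x : Eucl n} {a : Eucl m}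
    {α : ℝ → Eucl m} {ξ : ℝ → Eucl n} (hα : IsControl (s * L) a α) (hξ : IsTrajectory f x α ξ) :
    ∃ (β : ℝ → Eucl m) (η : ℝ → Eucl n), IsControl L a β ∧ IsTrajectory f x β η ∧
      reward r γ α ξ ≤ reward r γ β η +
        (s - 1) * (Kr * (Mf / K) / (γ - K) + 2 * Mr / γ) := by
  have hs0 : 0 < s := by linarith
  have hγ : 0 < γ := hKγ.trans' hK
  have hMr0 : 0 ≤ Mr := (norm_nonneg _).trans (hMr 0 0)
  obtain ⟨ζ, hζ0, hζ⟩ := exists_solution_smul ⟨Mf, hMf⟩ hf_lip hα.continuousOn s x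
  have hζc : ContinuousOn ζ (Ici 0) := fun t ht => (hζ t ht).continuousWithinAt
  refine ⟨fun t => α (s⁻¹ * t), fun t => ζ (s⁻¹ * t), ⟨fun t u ht hu => ?_, by simpa using hα.init⟩,
    ⟨by simpa using hζ0, fun t ht => ?_⟩, ?_⟩
  · refine (hα.lipschitz _ _ (by positivity) (by positivity)).trans (le_of_eq ?_)
    rw [← mul_sub, abs_mul, abs_of_pos (inv_pos.2 hs0)]
    field_simp
  · have h1 : HasDerivWithinAt (fun t : ℝ => s⁻¹ * t) s⁻¹ (Ici 0) t := by
      simpa using (hasDerivWithinAt_id t (Ici 0)).const_mul s⁻¹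
    have h2 := (hζ (s⁻¹ * t) (by positivity)).scomp t h1
      (fun u hu => mul_nonneg (inv_nonneg.2 hs0.le) hu)
    rwa [smul_smul, inv_mul_cancel₀ hs0.ne', one_smul] at h2
  -- The substitution returning to the original clock turns the discount rate into `γ s` and
  -- produces the factor `s`.
  · have hrew : reward r γ (fun t => α (s⁻¹ * t)) (fun t => ζ (s⁻¹ * t)) =
        ∫ t in Ioi (0 : ℝ), s * (Real.exp (-(γ * s) * t) * r (ζ t) (α t)) := by
      have h := integral_comp_mul_left_Ioi
        (fun t => Real.exp (-(γ * s) * t) * r (ζ t) (α t)) 0 (inv_pos.2 hs0)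
      rw [inv_inv, mul_zero, smul_eq_mul] at h
      rw [integral_const_mul, ← h, reward]
      congr 1
      ext t
      congr 2
      field_simp
    have hi1 : IntegrableOn (fun t => Real.exp (-γ * t) * r (ξ t) (α t)) (Ioi 0) :=
      integrableOn_discounted hMr hr_lip hγ hα.continuousOn hξ.continuousOn
    have hi2 : IntegrableOn (fun t => s * (Real.exp (-(γ * s) * t) * r (ζ t) (α t))) (Ioi 0) :=
      (integrableOn_discounted hMr hr_lip (by positivity) hα.continuousOn hζc).const_mul s
    have hγK : 0 < γ - K := by linarith
    have hγs : 0 < γ * s := by positivity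
    -- Integrable majorants: `hj1` pays for the gap between trajectories. The other two combine
    -- `(e^{-γt} - e^{-γst}) Mr` with `(s - 1) e^{-γst} Mr`, whence the coefficient `s - 2`.
    have hj1 := (integrableOn_exp_mul_Ioi (neg_neg_of_pos hγK) 0).const_mul
      ((s - 1) * (Kr * (Mf / K)))
    have hj2 := (integrableOn_exp_mul_Ioi (neg_neg_of_pos hγs) 0).const_mul ((s - 2) * Mr)
    have hj3 := (integrableOn_exp_mul_Ioi (neg_neg_of_pos hγ) 0).const_mul Mr
    rw [← sub_le_iff_le_add', hrew, reward, ← integral_sub hi1 hi2]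
    have hmono := setIntegral_mono_on (hi1.sub hi2) ((hj1.add hj2).add hj3) measurableSet_Ioi
      (fun t ht => ?_)
    · refine hmono.trans ?_
      rw [integral_add' (hj1.add hj2) hj3, integral_add' hj1 hj2, integral_const_mul,
        integral_const_mul, integral_const_mul, integral_exp_neg_mul_Ioi_zero hγK,
        integral_exp_neg_mul_Ioi_zero hγs, integral_exp_neg_mul_Ioi_zero hγ]
      have : (s - 1) * (Kr * (Mf / K) / (γ - K) + 2 * Mr / γ) -
          ((s - 1) * (Kr * (Mf / K)) * (1 / (γ - K)) + (s - 2) * Mr * (1 / (γ * s))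
            + Mr * (1 / γ)) = 2 * Mr / γ * ((s - 1) ^ 2 / s) := by
        field_simp
        ring
      have : 0 ≤ 2 * Mr / γ * ((s - 1) ^ 2 / s) := by positivity
      linarith
    · have ht0 : 0 ≤ t := (mem_Ioi.1 ht).le
      have hd := norm_sub_le_of_rescaled hMf hf_lip hKf hK hs hξ hζ0 hζ ht0
      have hr1 : r (ξ t) (α t) - r (ζ t) (α t) ≤ Kr * ‖ξ t - ζ t‖ := by
        have := hr_lip.norm_sub_le (ξ t) (ζ t) (α t) (α t)
        rw [sub_self, norm_zero, add_zero] at this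
        exact (le_abs_self _).trans this
      have hr2 := hr1.trans (mul_le_mul_of_nonneg_left hd Kr.2)
      have he := mul_le_mul_of_nonneg_left hr2 (Real.exp_nonneg (-γ * t))
      have hexp : Real.exp (-γ * t) * Real.exp (K * t) = Real.exp (-(γ - K) * t) := by
        rw [← Real.exp_add]; ring_nf
      have hle : Real.exp (-(γ * s) * t) ≤ Real.exp (-γ * t) := by
        apply Real.exp_le_exp.2
        nlinarith [mul_nonneg hγ.le ht0]
      have hrM := abs_le.1 (hMr (ζ t) (α t))
      have e1 : (Real.exp (-γ * t) - Real.exp (-(γ * s) * t)) * r (ζ t) (α t) ≤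
          (Real.exp (-γ * t) - Real.exp (-(γ * s) * t)) * Mr :=
        mul_le_mul_of_nonneg_left hrM.2 (by linarith)
      have e2 : (s - 1) * Real.exp (-(γ * s) * t) * (-r (ζ t) (α t)) ≤
          (s - 1) * Real.exp (-(γ * s) * t) * Mr :=
        mul_le_mul_of_nonneg_left (by linarith) (mul_nonneg (by linarith) (Real.exp_nonneg _))
      have e3 : Real.exp (-γ * t) * (Kr * ((s - 1) * (Mf / K) * Real.exp (K * t))) =
          (s - 1) * (Kr * (Mf / K)) * Real.exp (-(γ - K) * t) := by
        rw [← hexp]; ring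
      simp only [Pi.add_apply, Pi.sub_apply]
      linarith

lemma bddAbove_rewards {Mr γ : ℝ} (hMr : ∀ x a, ‖r x a‖ ≤ Mr) (hγ : 0 < γ) (L : ℝ)
    (x : Eucl n) (a : Eucl m) :
    BddAbove {J : ℝ | ∃ (α : ℝ → Eucl m) (ξ : ℝ → Eucl n),
      IsControl L a α ∧ IsTrajectory f x α ξ ∧ J = reward r γ α ξ} := by
  refine ⟨Mr / γ, ?_⟩
  rintro _ ⟨α, ξ, -, -, rfl⟩
  exact (le_abs_self _).trans (abs_reward_le hMr hγ α ξ)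

lemma reward_le_valueFun {Mr γ L : ℝ} (hMr : ∀ x a, ‖r x a‖ ≤ Mr) (hγ : 0 < γ)
    {x : Eucl n} {a : Eucl m} {α : ℝ → Eucl m} {ξ : ℝ → Eucl n} (hα : IsControl L a α)
    (hξ : IsTrajectory f x α ξ) : reward r γ α ξ ≤ valueFun f r γ L x a :=
  le_csSup (bddAbove_rewards hMr hγ L x a) ⟨α, ξ, hα, hξ, rfl⟩

lemma valueFun_le {Kf : ℝ≥0} {γ L c : ℝ} (hL : 0 ≤ L) (hf_bdd : IsBoundedFun f)
    (hf_lip : IsLipschitzWith Kf f) {x : Eucl n} {a : Eucl m}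
    (h : ∀ (α : ℝ → Eucl m) (ξ : ℝ → Eucl n), IsControl L a α → IsTrajectory f x α ξ →
      reward r γ α ξ ≤ c) : valueFun f r γ L x a ≤ c := by
  -- The constant control makes the set of rewards nonempty; otherwise `sSup` would take its default
  -- value `0`, which may exceed `c`.
  have hc : IsControl L a fun _ => a := ⟨fun s t _ _ => by simpa using by positivity, rfl⟩
  obtain ⟨ξ, hξ⟩ := exists_trajectory hf_bdd hf_lip hc.continuousOn x
  refine csSup_le ⟨_, _, ξ, hc, hξ, rfl⟩ ?_
  rintro _ ⟨α, ξ, hα, hξ, rfl⟩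
  exact h α ξ hα hξ

/-- Quantitative monotonicity in `L` of the value functions. -/
theorem valueFun_sub_bounds {Kf Kr K : ℝ≥0} {γ Mf Mr L ℓ : ℝ} (hMf : ∀ x a, ‖f x a‖ ≤ Mf)
    (hMr : ∀ x a, ‖r x a‖ ≤ Mr) (hf_lip : IsLipschitzWith Kf f) (hr_lip : IsLipschitzWith Kr r)
    (hKf : Kf ≤ K) (hK : 0 < K) (hKγ : K < γ) (hL : 0 < L) (hℓ : 0 < ℓ)
    (x : Eucl n) (a : Eucl m) :
    0 ≤ valueFun f r γ (L + ℓ) x a - valueFun f r γ L x a ∧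
      valueFun f r γ (L + ℓ) x a - valueFun f r γ L x a ≤
        2 * (Kr * (Mf / K) / (γ - K) + 2 * Mr / γ) * ℓ / (L + ℓ) := by
  have hγ : 0 < γ := hKγ.trans' hK
  have hMf0 : 0 ≤ Mf := (norm_nonneg _).trans (hMf 0 0)
  have hMr0 : 0 ≤ Mr := (norm_nonneg _).trans (hMr 0 0)
  have hLℓ : 0 < L + ℓ := by positivity
  have hγK : 0 < γ - K := by linarith
  have hB : 0 ≤ Kr * (Mf / K) / (γ - K) := by positivity
  constructor
  · rw [sub_nonneg]
    refine valueFun_le hL.le ⟨Mf, hMf⟩ hf_lip fun α ξ hα hξ => ?_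
    refine reward_le_valueFun hMr hγ ⟨fun s t hs ht => ?_, hα.init⟩ hξ
    exact (hα.lipschitz s t hs ht).trans
      (mul_le_mul_of_nonneg_right (by linarith) (abs_nonneg _))
  · set C := Kr * (Mf / K) / (γ - K) + 2 * Mr / γ
    have hC : 2 * Mr / γ ≤ C := by linarith
    have hC0 : 0 ≤ C := hC.trans' (by positivity)
    rw [sub_le_iff_le_add']
    refine valueFun_le hLℓ.le ⟨Mf, hMf⟩ hf_lip fun α ξ hα hξ => ?_
    -- If `ℓ ≤ L`, then `ℓ / L ≤ 2ℓ / (L + ℓ)`. If `L ≤ ℓ`, then `1 ≤ 2ℓ / (L + ℓ)` and the crude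
    -- bound `2 * Mr / γ` suffices.
    rcases le_total ℓ L with hle | hle
    · obtain ⟨β, η, hβ, hη, h⟩ := exists_rescaled_control (L := L) (s := (L + ℓ) / L) (γ := γ) hMf hMr
        hf_lip hr_lip hKf hK hKγ (by rw [le_div_iff₀ hL]; linarith)
        (by rwa [div_mul_cancel₀ _ hL.ne']) hξ
      have h1 := reward_le_valueFun hMr hγ hβ hη
      have h2 : ((L + ℓ) / L - 1) * C ≤ 2 * C * ℓ / (L + ℓ) := by
        have e : (L + ℓ) / L - 1 = ℓ / L := by field_simp; ring
        rw [e, div_mul_eq_mul_div, div_le_div_iff₀ hL hLℓ]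
        nlinarith [mul_nonneg (mul_nonneg hC0 hℓ.le) (sub_nonneg.2 hle)]
      linarith
    · have hc : IsControl L a fun _ => a := ⟨fun s t _ _ => by simpa using by positivity, rfl⟩
      obtain ⟨η, hη⟩ := exists_trajectory ⟨Mf, hMf⟩ hf_lip hc.continuousOn x
      have h1 := reward_le_valueFun hMr hγ hc hη
      have h2 := abs_le.1 (abs_reward_le hMr hγ α ξ)
      have h3 := abs_le.1 (abs_reward_le hMr hγ (fun _ => a) η)
      have h4 : C ≤ 2 * C * ℓ / (L + ℓ) := by
        rw [le_div_iff₀ hLℓ]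
        nlinarith
      have h5 : 2 * Mr / γ = Mr / γ + Mr / γ := by ring
      linarith

end ValueFunction

/-! ### From increments to the upper derivative. -/

/-- The two-sided increment bound implies the bound on the upper derivative. -/
lemma limsup_div_le {C : ℝ} (hC : 0 ≤ C) {g : ℝ → ℝ}
    (hg : ∀ L ℓ : ℝ, 0 < L → 0 < ℓ → g (L + ℓ) - g L ≤ C * ℓ / (L + ℓ)) {L : ℝ} (hL : 0 < L) :
    limsup (fun ℓ : ℝ => (((g (L + ℓ) - g L) / ℓ : ℝ) : EReal)) (𝓝[≠] 0) ≤
      ((C / L : ℝ) : EReal) := by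
  refine limsup_le_of_le (by isBoundedDefault) ?_
  filter_upwards [self_mem_nhdsWithin,
    mem_nhdsWithin_of_mem_nhds (Ioi_mem_nhds (neg_neg_of_pos hL))] with ℓ hne hlt
  rw [mem_Ioi] at hlt
  rw [EReal.coe_le_coe_iff]
  rcases lt_or_gt_of_ne hne with h | h
  -- For negative `ℓ` the base point is `L + ℓ`, so the denominator is exactly `L`.
  · have := hg (L + ℓ) (-ℓ) (by linarith) (by linarith)
    rw [add_neg_cancel_right] at this
    rw [div_le_iff_of_neg h]
    have e : C * -ℓ / L = -(C / L * ℓ) := by ring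
    linarith
  · have := hg L ℓ hL h
    rw [div_le_iff₀ h]
    refine this.trans ?_
    rw [div_mul_eq_mul_div]
    exact div_le_div_of_nonneg_left (by positivity) hL (by linarith)

end LipControl

end

/-! ### Choice of the constant. -/

theorem mainTheorem3 (n m : ℕ)
    (f : LipControl.Eucl n → LipControl.Eucl m → LipControl.Eucl n)
    (r : LipControl.Eucl n → LipControl.Eucl m → ℝ)
    (Kf Kr : ℝ≥0) (γ : ℝ)
    (hf_bdd : LipControl.IsBoundedFun f) (hr_bdd : LipControl.IsBoundedFun r)
    (hf_lip : LipControl.IsLipschitzWith Kf f) (hr_lip : LipControl.IsLipschitzWith Kr r)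
    (hγ : (Kf : ℝ) < γ) :
    ∃ C : ℝ,
      -- the value functions
      (∀ L ℓ : ℝ, 0 < L → 0 < ℓ → ∀ (x : LipControl.Eucl n) (a : LipControl.Eucl m),
        0 ≤ LipControl.valueFun f r γ (L + ℓ) x a - LipControl.valueFun f r γ L x a ∧
        LipControl.valueFun f r γ (L + ℓ) x a - LipControl.valueFun f r γ L x a
          ≤ C * ℓ / (L + ℓ)) ∧
      (∀ L : ℝ, 0 < L → ∀ (x : LipControl.Eucl n) (a : LipControl.Eucl m),
        limsup (fun ℓ : ℝ =>
          (((LipControl.valueFun f r γ (L + ℓ) x a - LipControl.valueFun f r γ L x a) / ℓ : ℝ)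
            : EReal)) (𝓝[≠] 0) ≤ ((C / L : ℝ) : EReal)) ∧
      -- arbitrary bounded viscosity solutions
      (∀ L ℓ : ℝ, 0 < L → 0 < ℓ →
        ∀ u v : LipControl.Eucl n → LipControl.Eucl m → ℝ,
        LipControl.IsBoundedViscositySolution f r γ L u →
        LipControl.IsBoundedViscositySolution f r γ (L + ℓ) v →
        ∀ (x : LipControl.Eucl n) (a : LipControl.Eucl m),
          0 ≤ v x a - u x a ∧ v x a - u x a ≤ C * ℓ / (L + ℓ)) ∧
      (∀ Q : ℝ → LipControl.Eucl n → LipControl.Eucl m → ℝ,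
        (∀ L : ℝ, 0 < L → LipControl.IsBoundedViscositySolution f r γ L (Q L)) →
        ∀ L : ℝ, 0 < L → ∀ (x : LipControl.Eucl n) (a : LipControl.Eucl m),
          limsup (fun ℓ : ℝ => (((Q (L + ℓ) x a - Q L x a) / ℓ : ℝ) : EReal)) (𝓝[≠] 0)
            ≤ ((C / L : ℝ) : EReal)) := by

  obtain ⟨Mf, hMf⟩ := hf_bdd
  obtain ⟨Mr, hMr⟩ := hr_bdd
  have hMf0 : 0 ≤ Mf := (norm_nonneg _).trans (hMf 0 0)
  have hMr0 : 0 ≤ Mr := (norm_nonneg _).trans (hMr 0 0)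
  -- Strictly above `Kf`, so that `K` is positive even if `Kf = 0`: the Gronwall bound divides by
  -- `K`.
  obtain ⟨K, hKf, hKγ⟩ : ∃ K : ℝ≥0, Kf < K ∧ (K : ℝ) < γ := by
    obtain ⟨k, h1, h2⟩ := exists_between hγ
    exact ⟨⟨k, Kf.2.trans h1.le⟩, h1, h2⟩
  have hK : 0 < K := hKf.trans_le' zero_le
  have hγ0 : 0 < γ := hγ.trans_le' Kf.2
  have hγf : 0 < γ - Kf := sub_pos.2 hγ
  have hγK : 0 < γ - K := sub_pos.2 hKγ
  -- The penalty slope must be at least `Kr / (γ - Kf)`; the `+ 1` makes it positive when `Kr = 0`.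
  have hP : 0 < ((Kr : ℝ) + 1) / (γ - Kf) := by positivity
  have hPγ : ((Kr : ℝ) + 1) / (γ - Kf) * Kf + Kr ≤ γ * (((Kr : ℝ) + 1) / (γ - Kf)) := by
    have : ((Kr : ℝ) + 1) / (γ - Kf) * (γ - Kf) = Kr + 1 := div_mul_cancel₀ _ hγf.ne'
    linarith
  set P := ((Kr : ℝ) + 1) / (γ - Kf)
  set C₁ := 2 * (Kr * (Mf / K) / (γ - K) + 2 * Mr / γ)
  set C₂ := (2 * Mr + (P + 1) * Mf) / γ
  have hC : 0 ≤ max C₁ C₂ := le_max_of_le_left (by positivity)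
  have hle : ∀ {c L ℓ : ℝ}, c ≤ max C₁ C₂ → 0 < L → 0 < ℓ →
      c * ℓ / (L + ℓ) ≤ max C₁ C₂ * ℓ / (L + ℓ) := fun hc hL hℓ => by gcongr
  have hval : ∀ L ℓ : ℝ, 0 < L → 0 < ℓ → ∀ (x : LipControl.Eucl n) (a : LipControl.Eucl m),
      0 ≤ LipControl.valueFun f r γ (L + ℓ) x a - LipControl.valueFun f r γ L x a ∧
      LipControl.valueFun f r γ (L + ℓ) x a - LipControl.valueFun f r γ L x a
        ≤ max C₁ C₂ * ℓ / (L + ℓ) := fun L ℓ hL hℓ x a =>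
    (LipControl.valueFun_sub_bounds hMf hMr hf_lip hr_lip hKf.le hK hKγ hL hℓ x a).imp_right
      fun h => h.trans (hle (le_max_left _ _) hL hℓ)
  have hvisc : ∀ L ℓ : ℝ, 0 < L → 0 < ℓ →
      ∀ u v : LipControl.Eucl n → LipControl.Eucl m → ℝ,
      LipControl.IsBoundedViscositySolution f r γ L u →
      LipControl.IsBoundedViscositySolution f r γ (L + ℓ) v →
      ∀ (x : LipControl.Eucl n) (a : LipControl.Eucl m),
        0 ≤ v x a - u x a ∧ v x a - u x a ≤ max C₁ C₂ * ℓ / (L + ℓ) :=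
    fun L ℓ hL hℓ u v hu hv x a =>
      (LipControl.IsBoundedViscositySolution.sub_bounds hMf hMr hf_lip hr_lip hγ0 hP hPγ hL hℓ
        hu hv x a).imp_right fun h => h.trans (hle (le_max_right _ _) hL hℓ)
  refine ⟨max C₁ C₂, hval, fun L hL x a => ?_, hvisc, fun Q hQ L hL x a => ?_⟩
  · exact LipControl.limsup_div_le (g := fun L => LipControl.valueFun f r γ L x a) hC
      (fun L ℓ hL hℓ => (hval L ℓ hL hℓ x a).2) hL
  · exact LipControl.limsup_div_le (g := fun L => Q L x a) hC
      (fun L ℓ hL hℓ => (hvisc L ℓ hL hℓ _ _ (hQ L hL) (hQ _ (by positivity)) x a).2) hL
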